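/- Let $G$ be a finite simple graph that is maximal planar: $G$ can be embedded in the plane (vertices as distinct points, edges as simple polygonal arcs between their ends, no edge passing through any other vertex, and no two edges meeting except at common end points), and inserting an edge between any two distinct non-adjacent vertices of $G$ gives a graph that cannot be so embedded. Let $K$ be the set of 3-cliques of $G$, i.e. of the sets of three mutually adjacent vertices. For $k\in K$, say that the removal of $k$ divides $G$ into $S$ and $S'$ if $S,S'$ are disjoint sets of vertices with $S\cup S'=V(G)\setminus k$ such that every path of $G$ from a vertex of $S$ to a vertex of $S'$ contains a vertex of $k$; here $S$ and $S'$ are both required to be nonempty whenever $k$ is separating, i.e. whenever such a division into two nonempty sets exists (otherwise one of them is empty). For every $k\in K$ choose such a division, and call a part of smaller order the interior $G^k_{in}$ of $k$ and the other part its exterior $G^k_{out}$, so that $|G^k_{in}|\le |G^k_{out}|$; if the orders are equal, the choice is arbitrary. For $k,k'\in K$ write $k\preceq_K k'$ if $k\cup G^k_{in}\subseteq k'\cup G^{k'}_{in}$. Say that $k'$ covers $k$ if $k\preceq_K k'$, $k\ne k'$, and there is no $z\in K\setminus\{k,k'\}$ with $k\preceq_K z\preceq_K k'$. Let $H$ be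 the directed graph with vertex set $K$ that has an edge from $k$ to $k'$ exactly if $k'$ covers $k$; then $k$ is called an incoming neighbour of $k'$. Theorem. For every such $G$ and every such choice of interiors, if $k_j\neq k_l$ are distinct incoming neighbours in $H$ of the same 3-clique $k_i$, then their interiors are disjoint: $G^{k_j}_{in}\cap G^{k_l}_{in}=\emptyset$. -/

import Mathlib

/-! Maximal planar graphs, the interiors and exteriors of their 3-cliques, and the hierarchical
graph on the set of 3-cliques. -/

namespace CliqueHierarchy

/-- The plane (only its affine structure is used). -/
abbrev Plane : Type := ℝ × ℝ

/-- `IsPolygonalArc p q A`: the set `A` is a simple polygonal arc with end points `p` and `q`,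
i.e. a chain of finitely many nondegenerate straight line segments in which each segment meets
the union of the later ones exactly in the end point that it shares with the next one. -/
inductive IsPolygonalArc : Plane → Plane → Set Plane → Prop
  | single {p q : Plane} (hpq : p ≠ q) : IsPolygonalArc p q (segment ℝ p q)
  | cons {p q r : Plane} {A : Set Plane} (hpq : p ≠ q) (hA : IsPolygonalArc q r A)
      (hmeet : segment ℝ p q ∩ A = {q}) : IsPolygonalArc p r (segment ℝ p q ∪ A)

/-- An embedding of the graph `G` in the plane: the vertices are distinct points, every edge is
a simple arc between its two ends, no edge passes through a vertex other than its ends, and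
two different edges meet at most in common end points. -/
structure PlaneEmbedding {V : Type*} (G : SimpleGraph V) where
  /-- the point that represents a vertex -/
  pos : V → Plane
  /-- the arc that represents an edge (its value at a non-edge is irrelevant) -/
  arc : Sym2 V → Set Plane
  pos_injective : Function.Injective pos
  isArc : ∀ u v : V, G.Adj u v → IsPolygonalArc (pos u) (pos v) (arc s(u, v))
  mem_of_pos_mem_arc : ∀ e ∈ G.edgeSet, ∀ w : V, pos w ∈ arc e → w ∈ e
  arc_inter_arc : ∀ e ∈ G.edgeSet, ∀ f ∈ G.edgeSet, e ≠ f →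
    ∀ x ∈ arc e ∩ arc f, ∃ w : V, w ∈ e ∧ w ∈ f ∧ pos w = x

/-- A graph is planar if it can be embedded in the plane. -/
def IsPlanar {V : Type*} (G : SimpleGraph V) : Prop :=
  Nonempty (PlaneEmbedding G)

/-- A graph is maximal planar if it is planar and no edge can be inserted between two of its
vertices without violating planarity. -/
def IsMaximalPlanar {V : Type*} (G : SimpleGraph V) : Prop :=
  IsPlanar G ∧ ∀ u v : V, u ≠ v → ¬ G.Adj u v → ¬ IsPlanar (G ⊔ SimpleGraph.edge u v)

/-- The set `K` of 3-cliques of `G`. A 3-clique is given by its set of vertices. -/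
abbrev ThreeClique {V : Type*} (G : SimpleGraph V) : Type _ :=
  {k : Finset V // G.IsNClique 3 k}

section

variable {V : Type*} [Fintype V] [DecidableEq V] (G : SimpleGraph V)

/-! All subgraphs below are induced subgraphs of `G`, so they are given by their vertex sets;
union, intersection and inclusion of such subgraphs are those of the vertex sets. -/

/-- The removal of `k` divides `G` into the (possibly empty) parts `S` and `T`: these partition
the vertices outside `k`, and every path of `G` between them passes through `k`. -/
structure Divides (k S T : Finset V) : Prop where
  disjoint : Disjoint S T
  union_eq : S ∪ T = kᶜ
  meets : ∀ u ∈ S, ∀ v ∈ T, ∀ p : G.Walk u v, ∃ w ∈ p.support, w ∈ k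

/-- `k` is separating: its removal divides `G` into two nonempty parts. -/
def IsSeparating (k : Finset V) : Prop :=
  ∃ S T : Finset V, Divides G k S T ∧ S.Nonempty ∧ T.Nonempty

/-- `S` and `T` are the two subgraphs obtained upon removal of `k`. If `k` is separating, both
are nonempty; if `k` is non-separating, then (by `Divides`) one of them is empty. -/
structure AreSides (k S T : Finset V) : Prop where
  divides : Divides G k S T
  nonempty : IsSeparating G k → S.Nonempty ∧ T.Nonempty

/-- A choice of interior and exterior for every 3-clique: among the two subgraphs obtained upon
removal, the interior is one of smaller order; in case of equal orders the choice is
arbitrary. -/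
structure Orientation where
  /-- the interior of a 3-clique -/
  interior : ThreeClique G → Finset V
  /-- the exterior of a 3-clique -/
  exterior : ThreeClique G → Finset V
  areSides : ∀ k : ThreeClique G, AreSides G k.1 (interior k) (exterior k)
  card_le : ∀ k : ThreeClique G, (interior k).card ≤ (exterior k).card

variable {G}

/-- The relation `k ≼ k'` on 3-cliques: the union of `k` and its interior is contained in the
union of `k'` and its interior. -/
def Orientation.LE (O : Orientation G) (k k' : ThreeClique G) : Prop :=
  k.1 ∪ O.interior k ⊆ k'.1 ∪ O.interior k'

/-- `x` covers `y`: `y` is strictly below `x` and no other 3-clique lies between them. -/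
def Orientation.Covers (O : Orientation G) (x y : ThreeClique G) : Prop :=
  O.LE y x ∧ y ≠ x ∧ ∀ z : ThreeClique G, O.LE y z → O.LE z x → z = y ∨ z = x

/-- The hierarchical graph `H`: its vertices are the 3-cliques, and there is a directed edge
from `k` to `k'` if `k'` covers `k`. -/
def Orientation.hierarchicalGraph (O : Orientation G) : Digraph (ThreeClique G) where
  Adj k k' := O.Covers k' k

/-- `k` is an incoming neighbour of `k'` in `H`: there is a directed edge from `k` to `k'`. -/
def Orientation.IsIncomingNeighbor (O : Orientation G) (k k' : ThreeClique G) : Prop :=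
  O.hierarchicalGraph.Adj k k'

end

end CliqueHierarchy

namespace CliqueHierarchy

open Set Topology Filter Metric

/-! The interiors form a laminar family: distinct 3-cliques have disjoint interiors or are
comparable (`Orientation.disjoint_or_le`). Two distinct incoming neighbours of one clique cannot be
comparable, since one of them would then lie strictly between the other and the clique that covers
both.

Laminarity rests on one property of maximal planar graphs: a nonempty vertex set outside a 3-clique
`k`, all of whose outside neighbours lie in `k`, is attached to every vertex of `k`
(`IsMaximalPlanar.exists_adj`). Hence a side of `k` that avoids `k'` is not split by `k'` and lies
on the same side of `k'` as any vertex of `k` outside `k'` (`Divides.side_subset`). If each clique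
meets the interior of the other, each exterior lies in the other interior, and the size condition
forces the cliques to coincide.

If the attachment failed at one vertex of `k`, the ends of the opposite edge `xy` would separate the
graph. In a drawing, the arc of `xy` does not disconnect the plane, so some face has vertices from
both parts on its boundary (`IsEdgeCut.exists_face`). These can be joined by an arc inside the face,
which contradicts maximality (`PlaneEmbedding.isPlanar_sup_edge`).

Since edges are polygonal, an arc is one or two rays near each of its points, and rays cut a small
disc into connected parts that touch all of them. So a face that touches an edge at an inner point
has the whole edge on its boundary. The Jordan curve theorem is not needed. -/

/-! ### Segments and simple polygonal arcs -/

theorem isClosed_segment (p q : Plane) : IsClosed (segment ℝ p q) := by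
  rw [← closure_openSegment]; exact isClosed_closure

theorem isCompact_segment (p q : Plane) : IsCompact (segment ℝ p q) := by
  rw [segment_eq_image_lineMap]
  exact isCompact_Icc.image AffineMap.lineMap_continuous

/-- The first point in which a segment, starting at `z`, meets a closed set. -/
theorem exists_first_hit {F : Set Plane} (hF : IsClosed F) {z q : Plane}
    (h : (segment ℝ z q ∩ F).Nonempty) :
    ∃ m ∈ segment ℝ z q ∩ F, segment ℝ z m ∩ F = {m} := by
  obtain ⟨m, hm, hmin⟩ := ((isCompact_segment z q).inter_right hF).exists_isMinOn h
    (f := fun y => dist z y) (by fun_prop)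
  refine ⟨m, hm, Subset.antisymm ?_ (singleton_subset_iff.2 ⟨right_mem_segment ℝ z m, hm.2⟩)⟩
  rintro y ⟨hy, hyF⟩
  have hyq : y ∈ segment ℝ z q :=
    (convex_segment z q).segment_subset (left_mem_segment ℝ z q) hm.1 hy
  have h1 : dist z m ≤ dist z y := hmin ⟨hyq, hyF⟩
  rw [mem_segment_iff_wbtw] at hy
  have h2 := hy.dist_add_dist
  exact mem_singleton_iff.2 (dist_le_zero.1 (by linarith))

theorem openSegment_subset_diff (p q : Plane) (h : p ≠ q) :
    openSegment ℝ p q ⊆ segment ℝ p q \ {p, q} := by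
  intro y hy
  refine ⟨openSegment_subset_segment _ _ _ hy, ?_⟩
  rintro (rfl | rfl)
  · exact h (left_mem_openSegment_iff.1 hy)
  · exact h (right_mem_openSegment_iff.1 hy)

theorem isPreconnected_of_openSegment_subset {p q : Plane} {T : Set Plane}
    (h₁ : openSegment ℝ p q ⊆ T) (h₂ : T ⊆ segment ℝ p q) : IsPreconnected T :=
  (convex_openSegment p q).isPreconnected.subset_closure h₁
    (h₂.trans (closure_openSegment p q).symm.subset)

namespace IsPolygonalArc

variable {p q r : Plane} {A : Set Plane}

theorem left_mem (h : IsPolygonalArc p q A) : p ∈ A := by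
  cases h with
  | single => exact left_mem_segment ℝ _ _
  | cons => exact Or.inl (left_mem_segment ℝ _ _)

theorem right_mem (h : IsPolygonalArc p q A) : q ∈ A := by
  induction h with
  | single => exact right_mem_segment ℝ _ _
  | cons _ _ _ ih => exact Or.inr ih

theorem ne (h : IsPolygonalArc p q A) : p ≠ q := by
  cases h with
  | single h => exact h
  | cons hpq hA hmeet =>
    rintro rfl
    exact hpq (hmeet.subset ⟨left_mem_segment ℝ _ _, hA.right_mem⟩)

theorem isClosed (h : IsPolygonalArc p q A) : IsClosed A := by
  induction h with
  | single => exact isClosed_segment _ _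
  | cons _ _ _ ih => exact (isClosed_segment _ _).union ih

theorem snoc (h : IsPolygonalArc p q A) (hqr : q ≠ r) (hmeet : A ∩ segment ℝ q r = {q}) :
    IsPolygonalArc p r (A ∪ segment ℝ q r) := by
  induction h with
  | single hpq => exact cons hpq (single hqr) hmeet
  | @cons p q₁ q A hpq hA hm ih =>
    have h1 : A ∩ segment ℝ q r = {q} :=
      Subset.antisymm ((inter_subset_inter_left _ subset_union_right).trans hmeet.subset)
        (singleton_subset_iff.2 ⟨hA.right_mem, left_mem_segment ℝ _ _⟩)
    rw [union_assoc]
    refine cons hpq (ih hqr h1) (Subset.antisymm ?_ ?_)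
    · rintro y ⟨hy, hyA | hyr⟩
      · exact hm.subset ⟨hy, hyA⟩
      · have hyq : y = q := hmeet.subset ⟨Or.inl hy, hyr⟩
        subst hyq
        exact hm.subset ⟨hy, hA.right_mem⟩
    · exact singleton_subset_iff.2 ⟨right_mem_segment ℝ _ _, Or.inl hA.left_mem⟩

theorem symm (h : IsPolygonalArc p q A) : IsPolygonalArc q p A := by
  induction h with
  | single hpq => rw [segment_symm]; exact single hpq.symm
  | cons hpq hA hm ih =>
    rw [segment_symm] at hm ⊢
    rw [union_comm]
    exact ih.snoc hpq.symm (by rw [inter_comm, hm])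

/-- The final part of an arc. -/
theorem exists_subarc (h : IsPolygonalArc p r A) {m : Plane} (hm : m ∈ A) (hmr : m ≠ r) :
    ∃ A' ⊆ A, IsPolygonalArc m r A' := by
  induction h with
  | @single p q hpq =>
    exact ⟨_, (convex_segment p q).segment_subset hm (right_mem_segment ℝ p q), single hmr⟩
  | @cons p q r A hpq hA hmeet ih =>
    by_cases hmA : m ∈ A
    · obtain ⟨A', hA', h'⟩ := ih hmA hmr
      exact ⟨A', hA'.trans subset_union_right, h'⟩
    · have hs := hm.resolve_right hmA
      have hsub := (convex_segment p q).segment_subset hs (right_mem_segment ℝ p q)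
      refine ⟨_, union_subset_union_left A hsub,
        cons (fun e => hmA (e ▸ hA.left_mem)) hA (Subset.antisymm ?_ ?_)⟩
      · exact (inter_subset_inter_left _ hsub).trans hmeet.subset
      · exact singleton_subset_iff.2 ⟨right_mem_segment ℝ _ _, hA.left_mem⟩

/-- An arc can be extended by a segment, after cutting off superfluous parts. -/
theorem exists_prepend (h : IsPolygonalArc q r A) {z : Plane} (hz : z ≠ r) :
    ∃ A' ⊆ segment ℝ z q ∪ A, IsPolygonalArc z r A' := by
  -- Going from `z` to `q` only as far as the first point `m` of the arc, and following the arc from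
  -- there, makes the result simple.
  obtain ⟨m, ⟨hmq, hmA⟩, hfirst⟩ :=
    exists_first_hit h.isClosed (z := z) (q := q) ⟨q, right_mem_segment ℝ _ _, h.left_mem⟩
  have hsub := (convex_segment z q).segment_subset (left_mem_segment ℝ z q) hmq
  by_cases hmr : m = r
  · subst hmr
    exact ⟨_, hsub.trans subset_union_left, single hz⟩
  · obtain ⟨A', hA', h'⟩ := h.exists_subarc hmA hmr
    by_cases hzm : z = m
    · subst hzm
      exact ⟨A', hA'.trans subset_union_right, h'⟩
    · refine ⟨_, union_subset_union hsub hA', cons hzm h' (Subset.antisymm ?_ ?_)⟩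
      · exact (inter_subset_inter_right _ hA').trans hfirst.subset
      · exact singleton_subset_iff.2 ⟨right_mem_segment ℝ _ _, h'.left_mem⟩

theorem right_notMem_segment (hA : IsPolygonalArc q r A) (hmeet : segment ℝ p q ∩ A = {q}) :
    r ∉ segment ℝ p q :=
  fun h => hA.ne (hmeet.subset ⟨h, hA.right_mem⟩).symm

theorem left_notMem (hpq : p ≠ q) (hmeet : segment ℝ p q ∩ A = {q}) : p ∉ A :=
  fun h => hpq (hmeet.subset ⟨left_mem_segment ℝ _ _, h⟩)

theorem isPreconnected_diff_right (h : IsPolygonalArc p r A) : IsPreconnected (A \ {r}) := by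
  induction h with
  | @single p q hpq =>
    exact isPreconnected_of_openSegment_subset
      ((openSegment_subset_diff p q hpq).trans (sdiff_subset_sdiff_right (by simp))) sdiff_subset
  | @cons p q r A hpq hA hmeet ih =>
    rw [union_sdiff_distrib, sdiff_singleton_eq_self (hA.right_notMem_segment hmeet)]
    exact IsPreconnected.union q (right_mem_segment ℝ p q) ⟨hA.left_mem, hA.ne⟩
      (convex_segment p q).isPreconnected ih

/-- An arc without its end points is connected. -/
theorem isPreconnected_diff_ends (h : IsPolygonalArc p r A) : IsPreconnected (A \ {p, r}) := by
  cases h with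
  | single hpq =>
    exact isPreconnected_of_openSegment_subset (openSegment_subset_diff p r hpq) sdiff_subset
  | @cons _ q _ A hpq hA hmeet =>
    have h1 : (segment ℝ p q ∪ A) \ {p, r} = segment ℝ p q \ {p} ∪ A \ {r} := by
      ext y
      have h2 : y ∈ segment ℝ p q → y ≠ r :=
        fun h e => hA.right_notMem_segment hmeet (e ▸ h)
      have h3 : y ∈ A → y ≠ p := fun h e => left_notMem hpq hmeet (e ▸ h)
      simp only [Set.mem_sdiff, mem_union, mem_insert_iff, mem_singleton_iff]
      tauto
    rw [h1]
    refine IsPreconnected.union q ⟨right_mem_segment ℝ p q, hpq.symm⟩ ⟨hA.left_mem, hA.ne⟩ ?_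
      hA.isPreconnected_diff_right
    exact isPreconnected_of_openSegment_subset
      ((openSegment_subset_diff p q hpq).trans (sdiff_subset_sdiff_right (by simp))) sdiff_subset

/-- Used to extend to the two ends whatever closed condition holds along the open arc. -/
theorem subset_closure_diff_ends (h : IsPolygonalArc p r A) : A ⊆ closure (A \ {p, r}) := by
  induction h with
  | @single p q hpq =>
    exact (closure_openSegment p q).symm.subset.trans
      (closure_mono (openSegment_subset_diff p q hpq))
  | @cons p q r A hpq hA hmeet ih =>
    refine union_subset ?_ (ih.trans (closure_mono ?_))
    · refine (closure_openSegment p q).symm.subset.trans (closure_mono fun y hy => ?_)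
      have := openSegment_subset_diff p q hpq hy
      refine ⟨Or.inl this.1, ?_⟩
      rintro (rfl | rfl)
      · exact this.2 (by simp)
      · exact hA.right_notMem_segment hmeet this.1
    · rintro y ⟨hy, hne⟩
      refine ⟨Or.inr hy, ?_⟩
      rintro (rfl | rfl)
      · exact left_notMem hpq hmeet hy
      · simp at hne

theorem isPreconnected (h : IsPolygonalArc p r A) : IsPreconnected A :=
  h.isPreconnected_diff_ends.subset_closure sdiff_subset h.subset_closure_diff_ends

end IsPolygonalArc

/-! ### The local shape of an arc: one or two rays -/

/-- The ray from `x` in direction `α`; it is the point `x` if `α = 0`. -/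
def ray (x α : Plane) : Set Plane := {y | ∃ s : ℝ, 0 ≤ s ∧ y = x + s • α}

theorem ray_zero (x : Plane) : ray x 0 = {x} := by
  ext y
  simp only [ray, smul_zero, add_zero, mem_ofPred_eq, mem_singleton_iff]
  exact ⟨fun ⟨_, _, h⟩ => h, fun h => ⟨0, le_rfl, h⟩⟩

theorem segment_subset_ray (p q : Plane) : segment ℝ p q ⊆ ray p (q - p) := by
  rw [segment_eq_image']
  rintro _ ⟨s, hs, rfl⟩
  exact ⟨s, hs.1, rfl⟩

theorem eventually_mem_segment_iff {p q : Plane} (hpq : p ≠ q) :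
    ∀ᶠ y in 𝓝 p, (y ∈ segment ℝ p q ↔ y ∈ ray p (q - p)) := by
  have hpos : 0 < ‖q - p‖ := norm_pos_iff.2 (sub_ne_zero.2 hpq.symm)
  filter_upwards [ball_mem_nhds p hpos] with y hy
  refine ⟨fun h => segment_subset_ray p q h, ?_⟩
  rintro ⟨s, hs, rfl⟩
  rw [segment_eq_image']
  refine ⟨s, ⟨hs, ?_⟩, rfl⟩
  rw [mem_ball, dist_eq_norm, add_sub_cancel_left, norm_smul, Real.norm_of_nonneg hs] at hy
  exact (lt_of_mul_lt_mul_right (by linarith) hpos.le).le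

theorem eventually_notMem {F : Set Plane} (hF : IsClosed F) {x : Plane} (hx : x ∉ F) :
    ∀ᶠ y in 𝓝 x, y ∉ F :=
  hF.isOpen_compl.mem_nhds hx

/-- Near `x` the set `A` consists of two different rays, one of which may be degenerate. -/
def HasRayGerm (A : Set Plane) (x : Plane) : Prop :=
  ∃ α β : Plane, α ≠ 0 ∧ ray x α ∩ ray x β ⊆ {x} ∧
    ∀ᶠ y in 𝓝 x, (y ∈ A ↔ y ∈ ray x α ∪ ray x β)

theorem hasRayGerm_segment {p q : Plane} (hpq : p ≠ q) {x : Plane} (hx : x ∈ segment ℝ p q) :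
    HasRayGerm (segment ℝ p q) x := by
  by_cases h1 : x = p
  · subst h1
    refine ⟨q - x, 0, sub_ne_zero.2 hpq.symm, by rw [ray_zero]; exact inter_subset_right, ?_⟩
    filter_upwards [eventually_mem_segment_iff hpq] with y hy
    rw [hy, ray_zero, mem_union, mem_singleton_iff]
    refine ⟨Or.inl, ?_⟩
    rintro (h | rfl)
    · exact h
    · exact ⟨0, le_rfl, by simp⟩
  by_cases h2 : x = q
  · subst h2
    refine ⟨p - x, 0, sub_ne_zero.2 hpq, by rw [ray_zero]; exact inter_subset_right, ?_⟩
    filter_upwards [eventually_mem_segment_iff hpq.symm] with y hy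
    rw [segment_symm, hy, ray_zero, mem_union, mem_singleton_iff]
    refine ⟨Or.inl, ?_⟩
    rintro (h | rfl)
    · exact h
    · exact ⟨0, le_rfl, by simp⟩
  have hsub : segment ℝ p q = segment ℝ x p ∪ segment ℝ x q := by
    apply Subset.antisymm
    · rw [segment_eq_image'] at hx
      obtain ⟨t, ht, rfl⟩ := hx
      rw [segment_eq_image' ℝ p q]
      rintro _ ⟨s, hs, rfl⟩
      rcases le_total s t with hst | hst
      · left
        have ht0 : 0 < t := lt_of_le_of_ne ht.1 fun e => h1 (by simp [← e])
        rw [segment_symm, segment_eq_image']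
        refine ⟨s / t, ⟨div_nonneg hs.1 ht.1, div_le_one_of_le₀ hst ht.1⟩, ?_⟩
        simp only [add_sub_cancel_left, smul_smul, div_mul_cancel₀ _ ht0.ne']
      · right
        have ht1 : 0 < 1 - t := sub_pos.2 (lt_of_le_of_ne ht.2 fun e => h2 (by simp [e]))
        rw [segment_eq_image']
        refine ⟨(s - t) / (1 - t), ⟨div_nonneg (sub_nonneg.2 hst) ht1.le,
          div_le_one_of_le₀ (by linarith [hs.2]) ht1.le⟩, ?_⟩
        have h3 : q - (p + t • (q - p)) = (1 - t) • (q - p) := by module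
        simp only [h3, smul_smul, div_mul_cancel₀ _ ht1.ne']
        module
    · exact union_subset ((convex_segment p q).segment_subset hx (left_mem_segment ℝ p q))
        ((convex_segment p q).segment_subset hx (right_mem_segment ℝ p q))
  refine ⟨p - x, q - x, sub_ne_zero.2 (Ne.symm h1), ?_, ?_⟩
  · rintro y ⟨⟨s, hs, rfl⟩, t, ht, h⟩
    rw [segment_eq_image'] at hx
    obtain ⟨τ, hτ, rfl⟩ := hx
    -- Along `q - p`, the two rays have coordinates `-(s * τ)` and `t * (1 - τ)`, of opposite signs,
    -- so a common point has both equal to zero.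
    have h3 : (s * τ + t * (1 - τ)) • (q - p) = 0 := by
      rw [add_right_inj, ← sub_eq_zero] at h
      rw [← neg_eq_zero, ← h]
      module
    have h4 := (smul_eq_zero.1 h3).resolve_right (sub_ne_zero.2 hpq.symm)
    have h5 : s * τ = 0 := by
      linarith [mul_nonneg hs hτ.1, mul_nonneg ht (sub_nonneg.2 hτ.2)]
    have h6 : s • (p - (p + τ • (q - p))) = (-(s * τ)) • (q - p) := by module
    rw [mem_singleton_iff]
    beta_reduce
    rw [h6, h5, neg_zero, zero_smul, add_zero]
  · filter_upwards [eventually_mem_segment_iff h1, eventually_mem_segment_iff h2] with y hp hq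
    rw [hsub, mem_union, mem_union, hp, hq]

namespace IsPolygonalArc

variable {p q r : Plane} {A : Set Plane}

theorem exists_left_ray (h : IsPolygonalArc p r A) :
    ∃ α : Plane, α ≠ 0 ∧ ∀ᶠ y in 𝓝 p, (y ∈ A ↔ y ∈ ray p α) := by
  cases h with
  | single hpq => exact ⟨r - p, sub_ne_zero.2 hpq.symm, eventually_mem_segment_iff hpq⟩
  | @cons _ q _ A hpq hA hmeet =>
    refine ⟨q - p, sub_ne_zero.2 hpq.symm, ?_⟩
    filter_upwards [eventually_mem_segment_iff hpq,
      eventually_notMem hA.isClosed (left_notMem hpq hmeet)] with y h1 h2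
    rw [← h1, mem_union, or_iff_left h2]

/-- Away from a joint, only one of the two closed pieces is present near `x`. At a joint, each piece
contributes one ray. -/
theorem hasRayGerm (h : IsPolygonalArc p r A) {x : Plane} (hx : x ∈ A) : HasRayGerm A x := by
  induction h with
  | single hpq => exact hasRayGerm_segment hpq hx
  | @cons p q r A hpq hA hmeet ih =>
    by_cases hxA : x ∈ A
    · by_cases hxs : x ∈ segment ℝ p q
      · have hxq : x = q := hmeet.subset ⟨hxs, hxA⟩
        subst hxq
        obtain ⟨β, hβ, hev⟩ := hA.exists_left_ray
        refine ⟨p - x, β, sub_ne_zero.2 hpq, ?_, ?_⟩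
        · rintro y ⟨⟨s, hs, rfl⟩, t, ht, h⟩
          -- The pieces agree with their rays only near `x`. A common point of the rays is therefore
          -- shrunk towards `x` by a small factor `u > 0`, which puts it in both pieces, and these
          -- share only `x`.
          have htend : Tendsto (fun u : ℝ => x + u • (s • (p - x))) (𝓝[>] 0) (𝓝 x) := by
            have : Continuous fun u : ℝ => x + u • (s • (p - x)) := by fun_prop
            simpa using (this.tendsto 0).mono_left nhdsWithin_le_nhds
          obtain ⟨u, ⟨h1, h2⟩, hu⟩ := ((htend.eventually
            ((eventually_mem_segment_iff hpq.symm).and hev)).and self_mem_nhdsWithin).exists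
          have hu0 : (0 : ℝ) < u := hu
          have h3 := h1.2 ⟨u * s, by positivity, by rw [smul_smul]⟩
          have h4 := h2.2 ⟨u * t, by positivity, by rw [add_right_inj] at h; rw [h, smul_smul]⟩
          have h5 := hmeet.subset ⟨by rwa [segment_symm], h4⟩
          simpa [hu0.ne'] using h5
        · filter_upwards [eventually_mem_segment_iff hpq.symm, hev] with y h1 h2
          rw [mem_union, mem_union, h2, segment_symm, h1]
      · obtain ⟨α, β, hα, hαβ, hev⟩ := ih hxA
        refine ⟨α, β, hα, hαβ, ?_⟩
        filter_upwards [hev, eventually_notMem (isClosed_segment p q) hxs] with y h1 h2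
        rw [← h1, mem_union, or_iff_right h2]
    · obtain ⟨α, β, hα, hαβ, hev⟩ := hasRayGerm_segment hpq (hx.resolve_right hxA)
      refine ⟨α, β, hα, hαβ, ?_⟩
      filter_upwards [hev, eventually_notMem hA.isClosed hxA] with y h1 h2
      rw [← h1, mem_union, or_iff_left h2]

end IsPolygonalArc

/-! ### Discs divided by rays -/

/-- Up to positive factors, the linear forms `g`, `f` are the coordinates with respect to the
basis `α`, `β` of the plane. -/
structure IsFrame (f g : Plane →ₗ[ℝ] ℝ) (α β : Plane) : Prop where
  f_left : f α = 0
  f_right : 0 < f β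
  g_left : 0 < g α
  g_right : g β = 0
  eq_zero : ∀ v, f v = 0 → g v = 0 → v = 0

/-- The linear form `v ↦ det (u, v)`. -/
def cross (u : Plane) : Plane →ₗ[ℝ] ℝ where
  toFun v := u.1 * v.2 - u.2 * v.1
  map_add' v w := by simp only [Prod.fst_add, Prod.snd_add]; ring
  map_smul' c v := by simp only [Prod.smul_fst, Prod.smul_snd, smul_eq_mul, RingHom.id_apply]; ring

theorem cross_apply (u v : Plane) : cross u v = u.1 * v.2 - u.2 * v.1 := rfl

theorem isFrame_cross {α β : Plane} (h : 0 < cross α β) : IsFrame (cross α) (-cross β) α β where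
  f_left := by rw [cross_apply]; ring
  f_right := h
  g_left := by rw [LinearMap.neg_apply, cross_apply]; rw [cross_apply] at h; linarith
  g_right := by rw [LinearMap.neg_apply, cross_apply]; ring
  eq_zero v h1 h2 := by
    rw [LinearMap.neg_apply, neg_eq_zero, cross_apply] at h2
    rw [cross_apply] at h h1
    ext
    · refine (mul_eq_zero.1 (?_ : (α.1 * β.2 - α.2 * β.1) * v.1 = 0)).resolve_left h.ne'
      linear_combination β.1 * h1 - α.1 * h2
    · refine (mul_eq_zero.1 (?_ : (α.1 * β.2 - α.2 * β.1) * v.2 = 0)).resolve_left h.ne'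
      linear_combination β.2 * h1 - α.2 * h2

theorem exists_cross_pos {α : Plane} (h : α ≠ 0) : ∃ β, 0 < cross α β := by
  -- The quarter turn of `α`, for which the determinant is the sum of the squares of the coordinates
  -- of `α`.
  refine ⟨(-α.2, α.1), ?_⟩
  rw [cross_apply]
  by_contra hle
  have h1 : α.1 = 0 := by nlinarith [sq_nonneg α.1, sq_nonneg α.2]
  have h2 : α.2 = 0 := by nlinarith [sq_nonneg α.1, sq_nonneg α.2]
  exact h (Prod.ext h1 h2)

namespace IsFrame

variable {f g : Plane →ₗ[ℝ] ℝ} {α β : Plane} (h : IsFrame f g α β)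
include h

theorem swap : IsFrame g f β α :=
  ⟨h.g_right, h.g_left, h.f_right, h.f_left, fun v h1 h2 => h.eq_zero v h2 h1⟩

theorem eq_add_smul {x y : Plane} (hf : f y = f x) : y = x + ((g y - g x) / g α) • α := by
  rw [← sub_eq_zero]
  apply h.eq_zero
  · simp [h.f_left, hf]
  · simp [div_mul_cancel₀ _ h.g_left.ne']

theorem mem_ray_left {x y : Plane} : y ∈ ray x α ↔ f y = f x ∧ g x ≤ g y := by
  constructor
  · rintro ⟨s, hs, rfl⟩
    simpa [h.f_left] using mul_nonneg hs h.g_left.le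
  · rintro ⟨h1, h2⟩
    exact ⟨_, div_nonneg (sub_nonneg.2 h2) h.g_left.le, h.eq_add_smul h1⟩

theorem mem_ray_right {x y : Plane} : y ∈ ray x β ↔ g y = g x ∧ f x ≤ f y :=
  h.swap.mem_ray_left

end IsFrame

theorem mem_closure_of_forall_pos {y v : Plane} {H : Set Plane} (h : ∀ t : ℝ, 0 < t → y + t • v ∈ H) :
    y ∈ closure H := by
  have htend : Tendsto (fun t : ℝ => y + t • v) (𝓝[>] 0) (𝓝 y) := by
    have : Continuous fun t : ℝ => y + t • v := by fun_prop
    simpa using (this.tendsto 0).mono_left nhdsWithin_le_nhds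
  exact mem_closure_of_tendsto htend (eventually_mem_nhdsWithin.mono fun t ht => h t ht)

theorem mem_closure_inter_of_forall_pos {y v : Plane} {B H : Set Plane} (hB : IsOpen B) (hy : y ∈ B)
    (h : ∀ t : ℝ, 0 < t → y + t • v ∈ H) : y ∈ closure (B ∩ H) :=
  hB.inter_closure ⟨hy, mem_closure_of_forall_pos h⟩

theorem convex_lt (f : Plane →ₗ[ℝ] ℝ) (x : Plane) : Convex ℝ {y | f x < f y} :=
  convex_halfSpace_gt f.isLinear _

theorem convex_gt (f : Plane →ₗ[ℝ] ℝ) (x : Plane) : Convex ℝ {y | f y < f x} :=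
  convex_halfSpace_lt f.isLinear _

theorem nonempty_of_closure {x : Plane} {s : Set Plane} (h : x ∈ closure s) : s.Nonempty :=
  closure_nonempty_iff.1 ⟨x, h⟩

/-- A disc is not disconnected by a ray that starts from its centre. -/
theorem isPreconnected_ball_diff_ray {α x : Plane} (hα : α ≠ 0) {ε : ℝ} (hε : 0 < ε) :
    IsPreconnected (ball x ε \ ray x α) := by
  obtain ⟨β, hβ⟩ := exists_cross_pos hα
  have h := isFrame_cross hβ
  set f := cross α
  set g := -cross β
  -- Three convex pieces: the half disc behind the ray overlaps the half discs on either side of it.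
  have hset : ball x ε \ ray x α =
      (ball x ε ∩ {y | g y < g x} ∪ ball x ε ∩ {y | f x < f y}) ∪ ball x ε ∩ {y | f y < f x} := by
    ext y
    simp only [Set.mem_sdiff, h.mem_ray_left, mem_union, mem_inter_iff, mem_ofPred_eq]
    rcases lt_trichotomy (f y) (f x) with h1 | h1 | h1
    · simp only [h1, h1.ne, h1.not_gt]; tauto
    · simp [h1]
    · simp only [h1, h1.ne', h1.not_gt]; tauto
  have hx := mem_ball_self (x := x) hε
  have hb := convex_ball x ε
  rw [hset]
  refine IsPreconnected.union' ?_ (IsPreconnected.union' ?_ (hb.inter (convex_gt g x)).isPreconnected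
    (hb.inter (convex_lt f x)).isPreconnected) (hb.inter (convex_gt f x)).isPreconnected
  · have : x ∈ closure (ball x ε ∩ ({y | g y < g x} ∩ {y | f y < f x})) :=
      mem_closure_inter_of_forall_pos isOpen_ball hx (v := -α - β) fun t ht => by
        simp [h.f_left, h.g_right, mul_pos ht h.f_right, mul_pos ht h.g_left]
    obtain ⟨y, h1, h2, h3⟩ := nonempty_of_closure this
    exact ⟨y, Or.inl ⟨h1, h2⟩, h1, h3⟩
  · have : x ∈ closure (ball x ε ∩ ({y | g y < g x} ∩ {y | f x < f y})) :=
      mem_closure_inter_of_forall_pos isOpen_ball hx (v := -α + β) fun t ht => by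
        simp [h.f_left, h.g_right, mul_pos ht h.f_right, mul_pos ht h.g_left]
    obtain ⟨y, h1, h2, h3⟩ := nonempty_of_closure this
    exact ⟨y, ⟨h1, h2⟩, h1, h3⟩

/-- Two rays divide a disc around their common end point into connected parts that touch both
rays: the case of independent directions. -/
theorem IsFrame.exists_isPreconnected {f g : Plane →ₗ[ℝ] ℝ} {α β : Plane} (h : IsFrame f g α β)
    {x z : Plane} {ε : ℝ} (hε : 0 < ε) (hz : z ∈ ball x ε) (hzn : z ∉ ray x α ∪ ray x β) :
    ∃ K : Set Plane, IsPreconnected K ∧ z ∈ K ∧ K ⊆ ball x ε \ (ray x α ∪ ray x β) ∧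
      ball x ε ∩ (ray x α ∪ ray x β) ⊆ closure K := by
  have hx := mem_ball_self (x := x) hε
  have hb := convex_ball x ε
  -- Either `z` lies in the convex sector spanned by the rays, or in the complementary one, which is
  -- a union of two overlapping half discs. The directions `α + β` and `-α - β` push points of the
  -- rays into these sectors.
  by_cases hcase : f x < f z ∧ g x < g z
  · refine ⟨ball x ε ∩ ({y | f x < f y} ∩ {y | g x < g y}),
      (hb.inter ((convex_lt f x).inter (convex_lt g x))).isPreconnected, ⟨hz, hcase⟩, ?_, ?_⟩
    · rintro y ⟨hy, h1, h2⟩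
      refine ⟨hy, ?_⟩
      rintro (h3 | h3)
      · exact h1.ne' (h.mem_ray_left.1 h3).1
      · exact h2.ne' (h.mem_ray_right.1 h3).1
    · rintro y ⟨hy, hr⟩
      refine mem_closure_inter_of_forall_pos isOpen_ball hy (v := α + β) fun t ht => ?_
      have h1 := mul_pos ht h.f_right
      have h2 := mul_pos ht h.g_left
      rcases hr with hr | hr
      · have := h.mem_ray_left.1 hr
        simp only [mem_inter_iff, mem_ofPred_eq, map_add, map_smul, h.f_left, h.g_right, smul_eq_mul]
        constructor <;> linarith
      · have := h.mem_ray_right.1 hr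
        simp only [mem_inter_iff, mem_ofPred_eq, map_add, map_smul, h.f_left, h.g_right, smul_eq_mul]
        constructor <;> linarith
  · refine ⟨ball x ε ∩ {y | f y < f x} ∪ ball x ε ∩ {y | g y < g x},
      IsPreconnected.union' ?_ (hb.inter (convex_gt f x)).isPreconnected
        (hb.inter (convex_gt g x)).isPreconnected, ?_, ?_, ?_⟩
    · have : x ∈ closure (ball x ε ∩ ({y | f y < f x} ∩ {y | g y < g x})) :=
        mem_closure_inter_of_forall_pos isOpen_ball hx (v := -α - β) fun t ht => by
          simp [h.f_left, h.g_right, mul_pos ht h.f_right, mul_pos ht h.g_left]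
      obtain ⟨y, h1, h2, h3⟩ := nonempty_of_closure this
      exact ⟨y, ⟨h1, h2⟩, h1, h3⟩
    · rw [mem_union, not_or, h.mem_ray_left, h.mem_ray_right] at hzn
      by_contra hcon
      simp only [mem_union, mem_inter_iff, mem_ofPred_eq, hz, true_and, not_or, not_lt] at hcon
      refine hcase ⟨lt_of_le_of_ne hcon.1 fun e => hzn.1 ⟨e.symm, hcon.2⟩,
        lt_of_le_of_ne hcon.2 fun e => hzn.2 ⟨e.symm, hcon.1⟩⟩
    · rintro y hy
      refine ⟨hy.elim And.left And.left, ?_⟩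
      rintro (h3 | h3)
      · have := h.mem_ray_left.1 h3
        rcases hy with ⟨-, h1⟩ | ⟨-, h1⟩
        · exact h1.ne this.1
        · exact h1.not_ge this.2
      · have := h.mem_ray_right.1 h3
        rcases hy with ⟨-, h1⟩ | ⟨-, h1⟩
        · exact h1.not_ge this.2
        · exact h1.ne this.1
    · rintro y ⟨hy, hr⟩
      rw [← inter_union_distrib_left]
      refine mem_closure_inter_of_forall_pos isOpen_ball hy (v := -α - β) fun t ht => ?_
      have h1 := mul_pos ht h.f_right
      have h2 := mul_pos ht h.g_left
      rcases hr with hr | hr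
      · left
        have := h.mem_ray_left.1 hr
        simp [h.f_left, this.1, h1]
      · right
        have := h.mem_ray_right.1 hr
        simp [h.g_right, this.1, h2]

/-- Two rays, one of them possibly degenerate, divide a disc around their common end point into
connected parts that touch both rays. -/
theorem exists_isPreconnected_of_rays {α β x z : Plane} (hα : α ≠ 0)
    (hαβ : ray x α ∩ ray x β ⊆ {x}) {ε : ℝ} (hε : 0 < ε) (hz : z ∈ ball x ε)
    (hzn : z ∉ ray x α ∪ ray x β) :
    ∃ K : Set Plane, IsPreconnected K ∧ z ∈ K ∧ K ⊆ ball x ε \ (ray x α ∪ ray x β) ∧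
      ball x ε ∩ (ray x α ∪ ray x β) ⊆ closure K := by
  rcases lt_trichotomy (cross α β) 0 with hc | hc | hc
  · have hc' : 0 < cross β α := by rw [cross_apply] at hc ⊢; linarith
    simpa only [union_comm] using (isFrame_cross hc').exists_isPreconnected hε hz
      (by rwa [union_comm])
  -- For parallel directions an auxiliary `n` completes the frame. Then either `β = 0`, and the disc
  -- is slit along one ray, or `β` is opposite to `α`, and the rays form a diameter with a half disc
  -- on each side.
  · obtain ⟨n, hn⟩ := exists_cross_pos hα
    have h := isFrame_cross hn
    set f := cross α
    set g := -cross n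
    have hx0 : x ∈ ray x α := ⟨0, le_rfl, by simp⟩
    by_cases hβ : β = 0
    · subst hβ
      have hun : ray x α ∪ ray x 0 = ray x α := by
        rw [ray_zero, union_eq_left]
        exact singleton_subset_iff.2 hx0
      rw [hun] at hzn ⊢
      refine ⟨_, isPreconnected_ball_diff_ray hα hε, ⟨hz, hzn⟩, Subset.rfl, ?_⟩
      rintro y ⟨hy, hr⟩
      rw [sdiff_eq]
      refine mem_closure_inter_of_forall_pos isOpen_ball hy (v := n) fun t ht hmem => ?_
      have h1 := (h.mem_ray_left.1 hr).1
      have h2 := (h.mem_ray_left.1 hmem).1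
      simp only [map_add, map_smul, smul_eq_mul] at h2
      linarith [mul_pos ht h.f_right]
    · obtain ⟨c, rfl⟩ : ∃ c : ℝ, β = c • α :=
        ⟨(g (x + β) - g x) / g α, by
          have := h.eq_add_smul (x := x) (y := x + β) (by rw [map_add, hc, add_zero])
          exact add_left_cancel this⟩
      have hc0 : c < 0 := by
        by_contra hge
        have h1 : x + c • α ∈ ray x α := ⟨c, not_lt.1 hge, rfl⟩
        have h2 : x + c • α ∈ ray x (c • α) := ⟨1, zero_le_one, by rw [one_smul]⟩
        exact hβ (by simpa using hαβ ⟨h1, h2⟩)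
      have hray : ∀ y ∈ ray x α ∪ ray x (c • α), f y = f x := by
        rintro y (⟨s, -, rfl⟩ | ⟨s, -, rfl⟩) <;> simp [h.f_left]
      have hzf : f z ≠ f x := by
        intro e
        rcases le_total (g x) (g z) with hle | hle
        · exact hzn (Or.inl (h.mem_ray_left.2 ⟨e, hle⟩))
        · refine hzn (Or.inr ⟨(g z - g x) / g α / c, div_nonneg_of_nonpos
            (div_nonpos_of_nonpos_of_nonneg (sub_nonpos.2 hle) h.g_left.le) hc0.le, ?_⟩)
          rw [smul_smul, div_mul_cancel₀ _ hc0.ne]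
          exact h.eq_add_smul e
      rcases lt_or_gt_of_ne hzf with hlt | hlt
      · refine ⟨ball x ε ∩ {y | f y < f x},
          ((convex_ball x ε).inter (convex_gt f x)).isPreconnected, ⟨hz, hlt⟩,
          fun y hy => ⟨hy.1, fun hr => hy.2.ne (hray y hr)⟩, ?_⟩
        rintro y ⟨hy, hr⟩
        refine mem_closure_inter_of_forall_pos isOpen_ball hy (v := -n) fun t ht => ?_
        simpa [hray y hr] using mul_pos ht h.f_right
      · refine ⟨ball x ε ∩ {y | f x < f y},
          ((convex_ball x ε).inter (convex_lt f x)).isPreconnected, ⟨hz, hlt⟩,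
          fun y hy => ⟨hy.1, fun hr => hy.2.ne' (hray y hr)⟩, ?_⟩
        rintro y ⟨hy, hr⟩
        refine mem_closure_inter_of_forall_pos isOpen_ball hy (v := n) fun t ht => ?_
        simpa [hray y hr] using mul_pos ht h.f_right
  · exact (isFrame_cross hc).exists_isPreconnected hε hz hzn

/-! ### Boundaries of faces, and the complement of an arc -/

theorem eq_connectedComponentIn_of_mem {F K : Set Plane} {y z : Plane} (hK : IsPreconnected K)
    (hKF : K ⊆ F) (hy : y ∈ K) (hyz : y ∈ connectedComponentIn F z) :
    K ⊆ connectedComponentIn F z := by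
  rw [connectedComponentIn_eq hyz]
  exact hK.subset_connectedComponentIn hy hKF

/-- A connected subset `T` of an arc `A` of a drawing `F`, of which `A` is the only part near `T`,
belongs to the boundary of every face whose boundary it meets. -/
theorem IsPolygonalArc.subset_closure_component {F A T : Set Plane} {p r w z : Plane}
    (hA : IsPolygonalArc p r A) (hAF : A ⊆ F) (hT : IsPreconnected T) (hTA : T ⊆ A)
    (hloc : ∀ x ∈ T, ∀ᶠ y in 𝓝 x, y ∈ F → y ∈ A) (hwT : w ∈ T)
    (hw : w ∈ closure (connectedComponentIn Fᶜ z)) :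
    T ⊆ closure (connectedComponentIn Fᶜ z) := by
  set R := connectedComponentIn Fᶜ z with hR
  -- The face enters a small disc around `x`, so it contains one of the connected parts of the disc,
  -- and the closure of that part contains all of `F` in the disc. Thus `T ∩ closure R` is both open
  -- and closed in `T`.
  have key : ∀ x ∈ T, x ∈ closure R → ∀ᶠ y in 𝓝 x, y ∈ F → y ∈ closure R := by
    intro x hxT hx
    obtain ⟨α, β, hα, hαβ, hev⟩ := hA.hasRayGerm (hTA hxT)
    obtain ⟨ε, hε, hball⟩ := Metric.eventually_nhds_iff_ball.1 (hev.and (hloc x hxT))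
    obtain ⟨z', hz'B, hz'R⟩ := mem_closure_iff.1 hx _ isOpen_ball (mem_ball_self hε)
    have hz'F : z' ∉ F := connectedComponentIn_subset _ _ hz'R
    obtain ⟨K, hK, hzK, hsub, hcl⟩ := exists_isPreconnected_of_rays hα hαβ hε hz'B
      fun h => hz'F (hAF ((hball z' hz'B).1.2 h))
    have hKF : K ⊆ Fᶜ := fun y hy hyF =>
      (hsub hy).2 ((hball y (hsub hy).1).1.1 ((hball y (hsub hy).1).2 hyF))
    have hKR := eq_connectedComponentIn_of_mem hK hKF hzK hz'R
    filter_upwards [ball_mem_nhds x hε] with y hy hyF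
    exact closure_mono hKR (hcl ⟨hy, (hball y hy).1.1 ((hball y hy).2 hyF)⟩)
  intro x hx
  by_contra hxR
  obtain ⟨y, hyT, hy1, hy2⟩ := hT {x | ∀ᶠ y in 𝓝 x, y ∈ F → y ∈ closure R} (closure R)ᶜ
    isOpen_setOfPred_eventually_nhds isClosed_closure.isOpen_compl
    (fun y hy => by
      by_cases h : y ∈ closure R
      · exact Or.inl (key y hy h)
      · exact Or.inr h) ⟨w, hwT, key w hwT hw⟩ ⟨x, hx, hxR⟩
  exact hy2 (hy1.self_of_nhds (hAF (hTA hyT)))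

/-- The first point of `F` on the way from `z` to `q` is reached without leaving the face of `z`. -/
theorem exists_mem_segment_closure_component {F : Set Plane} (hF : IsClosed F) {z q : Plane}
    (hz : z ∉ F) (hq : q ∈ F) :
    ∃ w ∈ segment ℝ z q, w ∈ F ∧ w ∈ closure (connectedComponentIn Fᶜ z) := by
  obtain ⟨m, ⟨hm, hmF⟩, hfirst⟩ := exists_first_hit hF (z := z) (q := q)
    ⟨q, right_mem_segment ℝ _ _, hq⟩
  have hzm : z ≠ m := fun e => hz (e ▸ hmF)
  have hsub : segment ℝ z m \ {m} ⊆ connectedComponentIn Fᶜ z := by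
    refine IsPreconnected.subset_connectedComponentIn
      (isPreconnected_of_openSegment_subset ((openSegment_subset_diff z m hzm).trans
        (sdiff_subset_sdiff_right (by simp))) sdiff_subset)
      ⟨left_mem_segment ℝ _ _, hzm⟩ ?_
    rintro y ⟨hy, hne⟩ hyF
    exact hne (hfirst.subset ⟨hy, hyF⟩)
  refine ⟨m, hm, hmF, closure_mono ((openSegment_subset_diff z m hzm).trans
    ((sdiff_subset_sdiff_right (by simp)).trans hsub)) ?_⟩
  rw [closure_openSegment]
  exact right_mem_segment ℝ _ _

/-- A polygonal arc does not separate the plane. -/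
theorem IsPolygonalArc.isPreconnected_compl {A : Set Plane} {p r : Plane}
    (hA : IsPolygonalArc p r A) : IsPreconnected Aᶜ := by
  have hp : ∀ z ∉ A, p ∈ closure (connectedComponentIn Aᶜ z) := by
    intro z hz
    obtain ⟨w, -, hwA, hw⟩ := exists_mem_segment_closure_component hA.isClosed hz hA.left_mem
    exact hA.subset_closure_component Subset.rfl hA.isPreconnected Subset.rfl
      (fun _ _ => Eventually.of_forall fun _ => id) hwA hw hA.left_mem
  obtain ⟨α, hα, hev⟩ := hA.exists_left_ray
  obtain ⟨ε, hε, hball⟩ := Metric.eventually_nhds_iff_ball.1 hev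
  have hpre := isPreconnected_ball_diff_ray (x := p) hα hε
  have hsub : ball p ε \ ray p α ⊆ Aᶜ := fun y hy hyA => hy.2 ((hball y hy.1).1 hyA)
  -- Every component of the complement has `p` on its boundary, yet a small disc around `p` slit
  -- along one ray is connected; so there is only one component.
  have key : ∀ z ∉ A, ball p ε \ ray p α ⊆ connectedComponentIn Aᶜ z := by
    intro z hz
    obtain ⟨y, hyB, hyR⟩ := mem_closure_iff.1 (hp z hz) _ isOpen_ball (mem_ball_self hε)
    exact eq_connectedComponentIn_of_mem hpre hsub
      ⟨hyB, fun h => connectedComponentIn_subset _ _ hyR ((hball y hyB).2 h)⟩ hyR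
  apply isPreconnected_of_forall_pair
  intro z hz z' hz'
  obtain ⟨y, hyB, hyR⟩ := mem_closure_iff.1 (hp z hz) _ isOpen_ball (mem_ball_self hε)
  have hy : y ∈ ball p ε \ ray p α :=
    ⟨hyB, fun h => connectedComponentIn_subset _ _ hyR ((hball y hyB).2 h)⟩
  refine ⟨connectedComponentIn Aᶜ z, connectedComponentIn_subset _ _,
    mem_connectedComponentIn hz, ?_, isPreconnected_connectedComponentIn⟩
  rw [connectedComponentIn_eq hyR, ← connectedComponentIn_eq (key z' hz' hy)]
  exact mem_connectedComponentIn hz'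

/-! ### Joining visible points by an arc in an open connected set -/

theorem segment_subset_ball {x y z : Plane} {ε : ℝ} (hy : y ∈ ball x ε) (hz : z ∈ ball x ε) :
    segment ℝ y z ⊆ ball x ε :=
  (convex_ball x ε).segment_subset hy hz

/-- Two points that are visible from a connected open set `R` are the ends of an arc in `R`. -/
theorem exists_arc_of_isPreconnected {R : Set Plane} (hRo : IsOpen R) (hR : IsPreconnected R)
    {u v z z' : Plane} (huv : u ≠ v) (hv : v ∉ R) (hz : z ∈ R) (hz' : z' ∈ R)
    (huz : segment ℝ u z ⊆ insert u R) (hvz : segment ℝ v z' ⊆ insert v R) :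
    ∃ A ⊆ insert u (insert v R), IsPolygonalArc u v A := by
  -- The points that can be joined to `v` within `R` and `v` form a relatively open and closed part
  -- of `R`, because arcs can be prolonged by segments inside small discs.
  set S : Set Plane := {y | ∃ A ⊆ insert v R, IsPolygonalArc y v A} with hS
  have hSR : ∀ {y y' : Plane} {ε : ℝ}, ball y ε ⊆ R → y' ∈ ball y ε → y' ∈ S →
      ball y ε ⊆ S := by
    rintro y y' ε hball hy' ⟨A, hAR, hA⟩ x hx
    obtain ⟨A', hA', h⟩ := hA.exists_prepend (z := x) fun e => hv (e ▸ hball hx)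
    exact ⟨A', hA'.trans (union_subset
      (((segment_subset_ball hx hy').trans hball).trans (subset_insert _ _)) hAR), h⟩
  have hsub : R ⊆ S := by
    intro y hy
    by_contra hyS
    obtain ⟨x, hxR, hx1, hx2⟩ := hR (interior S) (interior Sᶜ) isOpen_interior isOpen_interior
      (fun x hx => by
        obtain ⟨ε, hε, hball⟩ := Metric.isOpen_iff.1 hRo x hx
        by_cases h : (ball x ε ∩ S).Nonempty
        · obtain ⟨y', hy', hyS'⟩ := h
          exact Or.inl (mem_interior.2 ⟨_, hSR hball hy' hyS', isOpen_ball, mem_ball_self hε⟩)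
        · refine Or.inr (mem_interior.2 ⟨_, ?_, isOpen_ball, mem_ball_self hε⟩)
          exact fun y' hy' hyS' => h ⟨y', hy', hyS'⟩)
      ⟨z', hz', by
        obtain ⟨ε, hε, hball⟩ := Metric.isOpen_iff.1 hRo z' hz'
        refine mem_interior.2 ⟨_, hSR hball (mem_ball_self hε) ?_, isOpen_ball, mem_ball_self hε⟩
        have hvz' : v ≠ z' := fun e => hv (e ▸ hz')
        exact ⟨_, hvz, (IsPolygonalArc.single hvz').symm⟩⟩
      ⟨y, hy, by
        obtain ⟨ε, hε, hball⟩ := Metric.isOpen_iff.1 hRo y hy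
        refine mem_interior.2 ⟨_, fun x hx hxS => ?_, isOpen_ball, mem_ball_self hε⟩
        exact hyS (hSR hball hx hxS (mem_ball_self hε))⟩
    exact interior_subset hx2 (interior_subset hx1)
  obtain ⟨A, hAR, hA⟩ := hsub hz
  obtain ⟨A', hA', h⟩ := hA.exists_prepend huv
  refine ⟨A', hA'.trans (union_subset (huz.trans ?_) (hAR.trans (subset_insert _ _))), h⟩
  exact insert_subset_insert (subset_insert _ _)

/-- Near `x` the set `F` is a cone with apex `x` (or empty). -/
def IsConicalAt (F : Set Plane) (x : Plane) : Prop :=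
  ∀ᶠ y in 𝓝 x, ∀ t : ℝ, 0 < t → t ≤ 1 → x + t • (y - x) ∈ F → y ∈ F

theorem add_smul_mem_ball {x y : Plane} {ε t : ℝ} (hy : y ∈ ball x ε) (ht : 0 < t) (ht1 : t ≤ 1) :
    x + t • (y - x) ∈ ball x ε := by
  have hε : 0 < ε := pos_of_mem_ball hy
  refine segment_subset_ball (mem_ball_self hε) hy ?_
  rw [segment_eq_image']
  exact ⟨t, ⟨ht.le, ht1⟩, rfl⟩

theorem isConicalAt_of_notMem {F : Set Plane} (hF : IsClosed F) {x : Plane} (hx : x ∉ F) :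
    IsConicalAt F x := by
  obtain ⟨ε, hε, hball⟩ := Metric.eventually_nhds_iff_ball.1 (eventually_notMem hF hx)
  filter_upwards [ball_mem_nhds x hε] with y hy t ht ht1 h
  exact absurd h (hball _ (add_smul_mem_ball hy ht ht1))

theorem mem_ray_of_add_smul_mem {x y α : Plane} {t : ℝ} (ht : 0 < t)
    (h : x + t • (y - x) ∈ ray x α) : y ∈ ray x α := by
  obtain ⟨s, hs, h⟩ := h
  rw [add_right_inj] at h
  refine ⟨t⁻¹ * s, by positivity, ?_⟩
  rw [mul_smul, ← h, smul_smul, inv_mul_cancel₀ ht.ne', one_smul, add_sub_cancel]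

theorem IsPolygonalArc.isConicalAt {p r : Plane} {A : Set Plane} (hA : IsPolygonalArc p r A)
    (x : Plane) : IsConicalAt A x := by
  by_cases hx : x ∈ A
  · obtain ⟨α, β, -, -, hev⟩ := hA.hasRayGerm hx
    obtain ⟨ε, hε, hball⟩ := Metric.eventually_nhds_iff_ball.1 hev
    filter_upwards [ball_mem_nhds x hε] with y hy t ht ht1 h
    exact (hball y hy).2 (((hball _ (add_smul_mem_ball hy ht ht1)).1 h).imp
      (mem_ray_of_add_smul_mem ht) (mem_ray_of_add_smul_mem ht))
  · exact isConicalAt_of_notMem hA.isClosed hx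

theorem isConicalAt_singleton (p x : Plane) : IsConicalAt {p} x := by
  by_cases h : p = x
  · subst h
    refine Eventually.of_forall fun y t ht _ h => ?_
    simpa [ht.ne', sub_eq_zero] using h
  · exact isConicalAt_of_notMem isClosed_singleton (Ne.symm h)

theorem isConicalAt_iUnion {ι : Type*} [Finite ι] {F : ι → Set Plane} {x : Plane}
    (h : ∀ i, IsConicalAt (F i) x) : IsConicalAt (⋃ i, F i) x := by
  filter_upwards [eventually_all.2 h] with y hy t ht ht1 hmem
  obtain ⟨i, hi⟩ := mem_iUnion.1 hmem
  exact mem_iUnion.2 ⟨i, hy i t ht ht1 hi⟩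

theorem IsConicalAt.union {F F' : Set Plane} {x : Plane} (h : IsConicalAt F x)
    (h' : IsConicalAt F' x) : IsConicalAt (F ∪ F') x := by
  filter_upwards [h, h'] with y h1 h2 t ht ht1 hmem
  exact hmem.imp (h1 t ht ht1) (h2 t ht ht1)

/-- A boundary point of a face, near which the drawing is a cone, is visible from the face. -/
theorem IsConicalAt.exists_segment_subset {F : Set Plane} {x z : Plane} (h : IsConicalAt F x)
    (hx : x ∈ closure (connectedComponentIn Fᶜ z)) (hxF : x ∈ F) :
    ∃ y ∈ connectedComponentIn Fᶜ z,
      segment ℝ x y ⊆ insert x (connectedComponentIn Fᶜ z) := by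
  obtain ⟨ε, hε, hball⟩ := Metric.eventually_nhds_iff_ball.1 h
  obtain ⟨y, hyB, hyR⟩ := mem_closure_iff.1 hx _ isOpen_ball (mem_ball_self hε)
  have hyF : y ∉ F := connectedComponentIn_subset _ _ hyR
  have hxy : x ≠ y := fun e => hyF (e ▸ hxF)
  refine ⟨y, hyR, ?_⟩
  -- A point of `F` on the way from `x` to `y`, other than `x`, would by conicality force `y ∈ F`.
  have hsub : segment ℝ x y \ {x} ⊆ connectedComponentIn Fᶜ z := by
    refine eq_connectedComponentIn_of_mem (isPreconnected_of_openSegment_subset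
      ((openSegment_subset_diff x y hxy).trans (sdiff_subset_sdiff_right (by simp))) sdiff_subset)
      ?_ ⟨right_mem_segment ℝ _ _, hxy.symm⟩ hyR
    rintro y' ⟨hy', hne⟩ hyF'
    rw [segment_eq_image'] at hy'
    obtain ⟨t, ht, rfl⟩ := hy'
    refine hyF (hball y hyB t (lt_of_le_of_ne ht.1 fun e => hne ?_) ht.2 hyF')
    simp [← e]
  intro y' hy'
  by_cases e : y' = x
  · exact Or.inl e
  · exact Or.inr (hsub ⟨hy', e⟩)

/-! ### Drawings of graphs, and inserting an edge into a face -/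

namespace PlaneEmbedding

variable {V : Type*} {G : SimpleGraph V} (E : PlaneEmbedding G)

/-- The set of all points of the drawing. -/
def drawing : Set Plane := (⋃ e : G.edgeSet, E.arc e) ∪ ⋃ v, {E.pos v}

/-- The part of the drawing that consists of the vertices in `C` and the edges with an end
in `C`. -/
def star (C : Set V) : Set Plane :=
  (⋃ e : {e : V × V // e.1 ∈ C ∧ G.Adj e.1 e.2}, E.arc s(e.1.1, e.1.2)) ∪ ⋃ c : C, {E.pos c}

variable {E}

theorem mem_drawing {p : Plane} :
    p ∈ E.drawing ↔ (∃ u v, G.Adj u v ∧ p ∈ E.arc s(u, v)) ∨ ∃ v, p = E.pos v := by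
  simp only [drawing, mem_union, mem_iUnion, mem_singleton_iff, Subtype.exists, exists_prop,
    Sym2.exists, SimpleGraph.mem_edgeSet]

theorem mem_star {C : Set V} {p : Plane} :
    p ∈ E.star C ↔ (∃ u v, u ∈ C ∧ G.Adj u v ∧ p ∈ E.arc s(u, v)) ∨ ∃ v ∈ C, p = E.pos v := by
  simp [star, and_assoc, eq_comm]

theorem star_subset_drawing (C : Set V) : E.star C ⊆ E.drawing := by
  intro p hp
  rw [mem_star] at hp
  rw [mem_drawing]
  exact hp.imp (fun ⟨u, v, _, h⟩ => ⟨u, v, h⟩) fun ⟨v, _, h⟩ => ⟨v, h⟩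

theorem arc_subset_drawing {u v : V} (h : G.Adj u v) : E.arc s(u, v) ⊆ E.drawing :=
  fun _ hp => mem_drawing.2 (Or.inl ⟨u, v, h, hp⟩)

theorem pos_mem_drawing (v : V) : E.pos v ∈ E.drawing := mem_drawing.2 (Or.inr ⟨v, rfl⟩)

theorem isClosed_arc {u v : V} (h : G.Adj u v) : IsClosed (E.arc s(u, v)) :=
  (E.isArc u v h).isClosed

theorem eq_or_eq_of_pos_mem_arc {u v w : V} (h : G.Adj u v) (hw : E.pos w ∈ E.arc s(u, v)) :
    w = u ∨ w = v :=
  Sym2.mem_iff.1 (E.mem_of_pos_mem_arc s(u, v) h w hw)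

variable [Finite V]

theorem isClosed_star (C : Set V) : IsClosed (E.star C) :=
  (isClosed_iUnion_of_finite fun e => isClosed_arc e.2.2).union
    (isClosed_iUnion_of_finite fun _ => isClosed_singleton)

theorem isClosed_drawing : IsClosed E.drawing := by
  refine IsClosed.union (isClosed_iUnion_of_finite ?_)
    (isClosed_iUnion_of_finite fun _ => isClosed_singleton)
  rintro ⟨e, he⟩
  induction e with | _ u v => exact isClosed_arc he

theorem isConicalAt_drawing (x : Plane) : IsConicalAt E.drawing x := by
  refine IsConicalAt.union (isConicalAt_iUnion ?_)
    (isConicalAt_iUnion fun _ => isConicalAt_singleton _ _)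
  rintro ⟨e, he⟩
  induction e with | _ u v => exact (E.isArc u v he).isConicalAt x

theorem eventually_mem_arc {u v : V} (h : G.Adj u v) {x : Plane} (hx : x ∈ E.arc s(u, v))
    (hpos : ∀ w, x ≠ E.pos w) : ∀ᶠ y in 𝓝 x, y ∈ E.drawing → y ∈ E.arc s(u, v) := by
  have h1 : ∀ᶠ y in 𝓝 x, ∀ w, y ∉ ({E.pos w} : Set Plane) :=
    eventually_all.2 fun w => eventually_notMem isClosed_singleton (hpos w)
  have h2 : ∀ᶠ y in 𝓝 x, ∀ e : {e : V × V // G.Adj e.1 e.2 ∧ s(e.1, e.2) ≠ s(u, v)},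
      y ∉ E.arc s(e.1.1, e.1.2) := by
    refine eventually_all.2 fun e => eventually_notMem (isClosed_arc e.2.1) fun hxe => ?_
    obtain ⟨w, -, -, hw⟩ := E.arc_inter_arc _ e.2.1 _ h e.2.2 x ⟨hxe, hx⟩
    exact hpos w hw.symm
  filter_upwards [h1, h2] with y hy1 hy2 hy
  rcases mem_drawing.1 hy with ⟨a, b, hab, hyab⟩ | ⟨w, hw⟩
  · by_cases he : s(a, b) = s(u, v)
    · rwa [← he]
    · exact absurd hyab (hy2 ⟨(a, b), hab, he⟩)
  · exact absurd hw (hy1 w)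

/-- If the boundary of a face meets an edge outside one end of it, it contains the other end. -/
theorem pos_mem_closure_component {u v : V} (h : G.Adj u v) {x z : Plane}
    (hx : x ∈ E.arc s(u, v)) (hxv : x ≠ E.pos v)
    (hxz : x ∈ closure (connectedComponentIn E.drawingᶜ z)) :
    E.pos u ∈ closure (connectedComponentIn E.drawingᶜ z) := by
  by_cases hxu : x = E.pos u
  · rwa [← hxu]
  have harc := E.isArc u v h
  have := harc.subset_closure_component (z := z) (arc_subset_drawing h)
    harc.isPreconnected_diff_ends sdiff_subset
    (fun y hy => eventually_mem_arc h hy.1 fun w hw => by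
      have hyw := hy.1
      rw [hw] at hyw
      rcases eq_or_eq_of_pos_mem_arc h hyw with e | e
      · exact hy.2 (by simp [hw, e])
      · exact hy.2 (by simp [hw, e]))
    ⟨hx, by simp [hxu, hxv]⟩ hxz
  exact closure_minimal this isClosed_closure (harc.subset_closure_diff_ends harc.left_mem)

/-- Two vertices on the boundary of the same face can be joined by an additional edge. -/
theorem isPlanar_sup_edge {c d : V} (hcd : c ≠ d) (hadj : ¬ G.Adj c d) {z : Plane}
    (hc : E.pos c ∈ closure (connectedComponentIn E.drawingᶜ z))
    (hd : E.pos d ∈ closure (connectedComponentIn E.drawingᶜ z)) :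
    IsPlanar (G ⊔ SimpleGraph.edge c d) := by
  classical
  set R := connectedComponentIn E.drawingᶜ z with hR
  have hRF : R ⊆ E.drawingᶜ := connectedComponentIn_subset _ _
  obtain ⟨y, hy, hcy⟩ := (isConicalAt_drawing _).exists_segment_subset hc (pos_mem_drawing c)
  obtain ⟨y', hy', hdy⟩ := (isConicalAt_drawing _).exists_segment_subset hd (pos_mem_drawing d)
  obtain ⟨A, hAR, hA⟩ := exists_arc_of_isPreconnected (isClosed_drawing.isOpen_compl.connectedComponentIn)
    isPreconnected_connectedComponentIn (E.pos_injective.ne hcd)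
    (fun h => hRF h (pos_mem_drawing d)) hy hy' hcy hdy
  have hposA : ∀ w, E.pos w ∈ A → w ∈ s(c, d) := by
    intro w hw
    rw [Sym2.mem_iff]
    rcases hAR hw with h | h | h
    · exact Or.inl (E.pos_injective h)
    · exact Or.inr (E.pos_injective h)
    · exact absurd (pos_mem_drawing w) (hRF h)
  have hedge : ∀ e ∈ (G ⊔ SimpleGraph.edge c d).edgeSet, e ≠ s(c, d) → e ∈ G.edgeSet := by
    intro e he hne
    rw [SimpleGraph.edgeSet_sup, SimpleGraph.edgeSet_edge_of_ne hcd] at he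
    exact he.resolve_right hne
  have hinter : ∀ e ∈ G.edgeSet, ∀ x ∈ E.arc e ∩ A, ∃ w, w ∈ e ∧ w ∈ s(c, d) ∧ E.pos w = x := by
    rintro e he x ⟨hxe, hxA⟩
    rcases hAR hxA with rfl | rfl | h
    · exact ⟨c, E.mem_of_pos_mem_arc e he c hxe, by simp, rfl⟩
    · exact ⟨d, E.mem_of_pos_mem_arc e he d hxe, by simp, rfl⟩
    · induction e with | _ u v => exact absurd (arc_subset_drawing he hxe) (hRF h)
  refine ⟨⟨E.pos, fun e => if e = s(c, d) then A else E.arc e, E.pos_injective, ?_, ?_, ?_⟩⟩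
  · intro u v huv
    by_cases he : s(u, v) = s(c, d)
    · rw [if_pos he]
      rcases Sym2.eq_iff.1 he with ⟨rfl, rfl⟩ | ⟨rfl, rfl⟩
      · exact hA
      · exact hA.symm
    · rw [if_neg he]
      exact E.isArc u v (hedge _ huv he)
  · intro e he w hw
    by_cases h : e = s(c, d)
    · rw [if_pos h] at hw
      exact h ▸ hposA w hw
    · rw [if_neg h] at hw
      exact E.mem_of_pos_mem_arc e (hedge e he h) w hw
  · intro e he f hf hef x hx
    by_cases h : e = s(c, d)
    · have h' : f ≠ s(c, d) := fun h' => hef (h.trans h'.symm)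
      rw [if_pos h, if_neg h'] at hx
      obtain ⟨w, h1, h2, h3⟩ := hinter f (hedge f hf h') x ⟨hx.2, hx.1⟩
      exact ⟨w, h ▸ h2, h1, h3⟩
    · by_cases h' : f = s(c, d)
      · rw [if_neg h, if_pos h'] at hx
        obtain ⟨w, h1, h2, h3⟩ := hinter e (hedge e he h) x hx
        exact ⟨w, h1, h' ▸ h2, h3⟩
      · rw [if_neg h, if_neg h'] at hx
        exact E.arc_inter_arc e (hedge e he h) f (hedge f hf h') hef x hx

end PlaneEmbedding

/-! ### Edges whose ends separate the graph -/

/-- The ends of the edge `xy` separate the vertex sets `C` and `D`. -/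
structure IsEdgeCut {V : Type*} (G : SimpleGraph V) (x y : V) (C D : Set V) : Prop where
  adj : G.Adj x y
  cover : ∀ v, v ∈ C ∨ v ∈ D ∨ v = x ∨ v = y
  disjoint : Disjoint C D
  ne : ∀ v, v ∈ C ∨ v ∈ D → v ≠ x ∧ v ≠ y
  not_adj : ∀ c ∈ C, ∀ d ∈ D, ¬ G.Adj c d

namespace IsEdgeCut

variable {V : Type*} {G : SimpleGraph V} {x y : V} {C D : Set V}

theorem symm (h : IsEdgeCut G x y C D) : IsEdgeCut G x y D C where
  adj := h.adj
  cover v := by have := h.cover v; tauto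
  disjoint := h.disjoint.symm
  ne v hv := h.ne v hv.symm
  not_adj c hc d hd hcd := h.not_adj d hd c hc hcd.symm

variable (h : IsEdgeCut G x y C D) {E : PlaneEmbedding G}
include h

open PlaneEmbedding

theorem pos_mem_arc {v : V} (hC : v ∉ C) (hD : v ∉ D) : E.pos v ∈ E.arc s(x, y) := by
  rcases h.cover v with hv | hv | rfl | rfl
  · exact absurd hv hC
  · exact absurd hv hD
  · exact (E.isArc _ _ h.adj).left_mem
  · exact (E.isArc _ _ h.adj).right_mem

theorem drawing_subset : E.drawing ⊆ E.star C ∪ E.star D ∪ E.arc s(x, y) := by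
  intro p hp
  rw [mem_union, mem_union, mem_star, mem_star]
  rcases mem_drawing.1 hp with ⟨u, v, huv, hpuv⟩ | ⟨v, rfl⟩
  · by_cases huC : u ∈ C
    · exact Or.inl (Or.inl (Or.inl ⟨u, v, huC, huv, hpuv⟩))
    by_cases huD : u ∈ D
    · exact Or.inl (Or.inr (Or.inl ⟨u, v, huD, huv, hpuv⟩))
    by_cases hvC : v ∈ C
    · exact Or.inl (Or.inl (Or.inl ⟨v, u, hvC, huv.symm, Sym2.eq_swap ▸ hpuv⟩))
    by_cases hvD : v ∈ D
    · exact Or.inl (Or.inr (Or.inl ⟨v, u, hvD, huv.symm, Sym2.eq_swap ▸ hpuv⟩))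
    right
    have h1 := (h.cover u).resolve_left huC |>.resolve_left huD
    have h2 := (h.cover v).resolve_left hvC |>.resolve_left hvD
    rcases h1 with rfl | rfl <;> rcases h2 with rfl | rfl
    · exact absurd huv (G.loopless.irrefl _)
    · exact hpuv
    · rwa [Sym2.eq_swap]
    · exact absurd huv (G.loopless.irrefl _)
  · by_cases hvC : v ∈ C
    · exact Or.inl (Or.inl (Or.inr ⟨v, hvC, rfl⟩))
    by_cases hvD : v ∈ D
    · exact Or.inl (Or.inr (Or.inr ⟨v, hvD, rfl⟩))
    exact Or.inr (h.pos_mem_arc hvC hvD)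

theorem notMem_of_pos_mem_star {v : V} (hv : E.pos v ∈ E.star C) : v ∉ D := by
  intro hvD
  rcases mem_star.1 hv with ⟨a, b, haC, hab, hvab⟩ | ⟨c, hc, hcv⟩
  · rcases eq_or_eq_of_pos_mem_arc hab hvab with rfl | rfl
    · exact disjoint_left.1 h.disjoint haC hvD
    · exact h.not_adj a haC v hvD hab
  · exact disjoint_left.1 h.disjoint hc (E.pos_injective hcv ▸ hvD)

/-- No edge belongs to both stars, so a common point is a vertex; it lies in neither `C` nor `D`,
hence is `x` or `y`. -/
theorem star_inter_star_subset : E.star C ∩ E.star D ⊆ E.arc s(x, y) := by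
  rintro p ⟨hC, hD⟩
  obtain ⟨w, rfl⟩ : ∃ w, p = E.pos w := by
    rcases mem_star.1 hC with ⟨a, b, haC, hab, hpab⟩ | ⟨c, -, hc⟩
    · rcases mem_star.1 hD with ⟨a', b', haD, hab', hpab'⟩ | ⟨d, -, hd⟩
      · have hne : s(a, b) ≠ s(a', b') := by
          intro e
          rcases Sym2.eq_iff.1 e with ⟨rfl, rfl⟩ | ⟨rfl, rfl⟩
          · exact disjoint_left.1 h.disjoint haC haD
          · exact h.not_adj _ haC _ haD hab
        obtain ⟨w, -, -, hw⟩ := E.arc_inter_arc _ hab _ hab' hne p ⟨hpab, hpab'⟩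
        exact ⟨w, hw.symm⟩
      · exact ⟨d, hd⟩
    · exact ⟨c, hc⟩
  exact h.pos_mem_arc (h.symm.notMem_of_pos_mem_star hD) (h.notMem_of_pos_mem_star hC)

variable [Finite V]

/-- Contact with a face passes along an edge to its end in `C`. Points of the arc of `xy` are
excluded because `x` and `y` themselves may lie in the star. -/
theorem exists_pos_mem_closure {p z : Plane} (hp : p ∈ E.star C) (hpA : p ∉ E.arc s(x, y))
    (hpz : p ∈ closure (connectedComponentIn E.drawingᶜ z)) :
    ∃ c ∈ C, E.pos c ∈ closure (connectedComponentIn E.drawingᶜ z) := by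
  by_cases hpos : ∃ w, p = E.pos w
  · obtain ⟨w, rfl⟩ := hpos
    refine ⟨w, ?_, hpz⟩
    by_contra hw
    exact hpA (h.pos_mem_arc hw (h.notMem_of_pos_mem_star hp))
  · rw [not_exists] at hpos
    rcases mem_star.1 hp with ⟨a, b, haC, hab, hpab⟩ | ⟨c, -, hc⟩
    · exact ⟨a, haC, pos_mem_closure_component hab hpab (hpos b) hpz⟩
    · exact absurd hc (hpos c)

/-- Near `z` the drawing consists of the star of `C` alone, so a nearby point off the drawing, when
moved straight towards `z`, first hits that star. -/
theorem eventually_star {z : Plane} (hz : z ∈ E.star C) (hzA : z ∉ E.arc s(x, y)) :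
    ∀ᶠ z' in 𝓝 z, z' ∈ E.star C ∨ (z' ∉ E.drawing ∧
      ∃ p ∈ E.star C, p ∉ E.arc s(x, y) ∧ p ∈ closure (connectedComponentIn E.drawingᶜ z')) := by
  have hzD : z ∉ E.star D := fun hzD => hzA (h.star_inter_star_subset ⟨hz, hzD⟩)
  obtain ⟨ε, hε, hball⟩ := Metric.eventually_nhds_iff_ball.1
    ((eventually_notMem (isClosed_star D) hzD).and (eventually_notMem (isClosed_arc h.adj) hzA))
  have hC : ∀ w ∈ ball z ε, w ∈ E.drawing → w ∈ E.star C := fun w hw hwF =>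
    ((h.drawing_subset hwF).resolve_right (hball w hw).2).resolve_right (hball w hw).1
  filter_upwards [ball_mem_nhds z hε] with z' hz'
  by_cases hF : z' ∈ E.drawing
  · exact Or.inl (hC z' hz' hF)
  · obtain ⟨w, hw, hwF, hcl⟩ := exists_mem_segment_closure_component isClosed_drawing hF
      (star_subset_drawing C hz)
    have hwB := segment_subset_ball hz' (mem_ball_self hε) hw
    exact Or.inr ⟨hF, w, hC w hwB hwF, (hball w hwB).2, hcl⟩

/-- Some face has a vertex of `C` and a vertex of `D` on its boundary. -/
theorem exists_face (hC : C.Nonempty) (hD : D.Nonempty) : ∃ z : Plane,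
    (∃ c ∈ C, E.pos c ∈ closure (connectedComponentIn E.drawingᶜ z)) ∧
    ∃ d ∈ D, E.pos d ∈ closure (connectedComponentIn E.drawingᶜ z) := by
  by_contra hno
  -- `P` is the star of `C` together with the faces that touch it off the arc of `xy`. If no face
  -- touched both sides, `P` and its complement would split the connected complement of that arc
  -- into two open parts.
  set P : Set Plane := {z | z ∈ E.star C ∨ (z ∉ E.drawing ∧ ∃ p ∈ E.star C,
    p ∉ E.arc s(x, y) ∧ p ∈ closure (connectedComponentIn E.drawingᶜ z))} with hP
  have hPC : ∀ z ∈ E.star C, z ∉ E.arc s(x, y) → z ∈ interior P := fun z hz hzA =>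
    mem_interior_iff_mem_nhds.2 (h.eventually_star hz hzA)
  have hPD : ∀ z ∈ E.star D, z ∉ E.arc s(x, y) → z ∈ interior Pᶜ := by
    intro z hz hzA
    have hzC : z ∉ E.star C := fun hzC => hzA (h.star_inter_star_subset ⟨hzC, hz⟩)
    rw [mem_interior_iff_mem_nhds]
    filter_upwards [h.symm.eventually_star hz hzA, eventually_notMem (isClosed_star C) hzC]
      with z' h1 h2
    rintro (h3 | ⟨h3, p, hp, hpA, hpcl⟩)
    · exact h2 h3
    · rcases h1 with h1 | ⟨-, q, hq, hqA, hqcl⟩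
      · exact h3 (star_subset_drawing D h1)
      · exact hno ⟨z', h.exists_pos_mem_closure hp hpA hpcl,
          h.symm.exists_pos_mem_closure hq hqA hqcl⟩
  have hcover : (E.arc s(x, y))ᶜ ⊆ interior P ∪ interior Pᶜ := by
    intro z hzA
    by_cases hzF : z ∈ E.drawing
    · rcases h.drawing_subset hzF with (hz | hz) | hz
      · exact Or.inl (hPC z hz hzA)
      · exact Or.inr (hPD z hz hzA)
      · exact absurd hz hzA
    · have hopen : IsOpen (connectedComponentIn E.drawingᶜ z) :=
        isClosed_drawing.isOpen_compl.connectedComponentIn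
      have hmem : z ∈ connectedComponentIn E.drawingᶜ z := mem_connectedComponentIn hzF
      -- Off the drawing, membership in `P` depends only on the face, and faces are open.
      have hiff : ∀ z' ∈ connectedComponentIn E.drawingᶜ z, (z' ∈ P ↔ z ∈ P) := by
        intro z' hz'
        have hz'F : z' ∉ E.drawing := connectedComponentIn_subset _ _ hz'
        have h1 : z ∉ E.star C := fun h => hzF (star_subset_drawing C h)
        have h2 : z' ∉ E.star C := fun h => hz'F (star_subset_drawing C h)
        simp only [hP, mem_ofPred_eq, h1, h2, hzF, hz'F, connectedComponentIn_eq hz']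
      by_cases hzP : z ∈ P
      · exact Or.inl (mem_interior.2 ⟨_, fun z' hz' => (hiff z' hz').2 hzP, hopen, hmem⟩)
      · exact Or.inr (mem_interior.2 ⟨_, fun z' hz' hz'P => hzP ((hiff z' hz').1 hz'P), hopen,
          hmem⟩)
  have hout : ∀ v, v ∈ C ∨ v ∈ D → E.pos v ∉ E.arc s(x, y) := fun v hv hmem =>
    (eq_or_eq_of_pos_mem_arc h.adj hmem).elim (h.ne v hv).1 (h.ne v hv).2
  obtain ⟨c, hc⟩ := hC
  obtain ⟨d, hd⟩ := hD
  obtain ⟨z, -, hz1, hz2⟩ := (E.isArc x y h.adj).isPreconnected_compl _ _ isOpen_interior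
    isOpen_interior hcover
    ⟨E.pos c, hout c (Or.inl hc), hPC _ (mem_star.2 (Or.inr ⟨c, hc, rfl⟩)) (hout c (Or.inl hc))⟩
    ⟨E.pos d, hout d (Or.inr hd), hPD _ (mem_star.2 (Or.inr ⟨d, hd, rfl⟩)) (hout d (Or.inr hd))⟩
  exact interior_subset hz2 (interior_subset hz1)

end IsEdgeCut

/-- No edge of a maximal planar graph is a cut. -/
theorem IsMaximalPlanar.not_isEdgeCut {V : Type*} [Finite V] {G : SimpleGraph V}
    (hG : IsMaximalPlanar G) {x y : V} {C D : Set V} (hC : C.Nonempty) (hD : D.Nonempty) :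
    ¬ IsEdgeCut G x y C D := by
  intro h
  obtain ⟨E⟩ := hG.1
  obtain ⟨z, ⟨c, hc, hcz⟩, d, hd, hdz⟩ := h.exists_face (E := E) hC hD
  have hcd : c ≠ d := fun e => Set.disjoint_left.1 h.disjoint hc (e ▸ hd)
  exact hG.2 c d hcd (h.not_adj c hc d hd)
    (PlaneEmbedding.isPlanar_sup_edge hcd (h.not_adj c hc d hd) hcz hdz)

/-! ### Sides of 3-cliques -/

section

variable {V : Type*} [Fintype V] [DecidableEq V] {G : SimpleGraph V}

/-- In a maximal planar graph, every part that a 3-clique cuts off is attached to all vertices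
of the clique. -/
theorem IsMaximalPlanar.exists_adj (hG : IsMaximalPlanar G) {k : Finset V} (hk : G.IsNClique 3 k)
    {a : V} (ha : a ∈ k) {S : Finset V} (hS : S.Nonempty) (hSk : Disjoint S k)
    (hclosed : ∀ s ∈ S, ∀ t, G.Adj s t → t ∈ S ∨ t ∈ k) : ∃ s ∈ S, G.Adj s a := by
  by_contra hno
  push Not at hno
  have hcard : (k.erase a).card = 2 := by rw [Finset.card_erase_of_mem ha, hk.card_eq]
  obtain ⟨x, y, hxy, hk'⟩ := Finset.card_eq_two.1 hcard
  have hx : x ≠ a ∧ x ∈ k := Finset.mem_erase.1 (hk' ▸ Finset.mem_insert_self x {y})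
  have hy : y ≠ a ∧ y ∈ k := Finset.mem_erase.1 (hk' ▸ by simp)
  have hmem : ∀ v ∈ k, v = a ∨ v = x ∨ v = y := by
    intro v hv
    by_cases hva : v = a
    · exact Or.inl hva
    · have : v ∈ k.erase a := Finset.mem_erase.2 ⟨hva, hv⟩
      rw [hk'] at this
      simpa using Or.inr this
  have hSk' : ∀ v ∈ S, v ∉ k := fun v hv => Finset.disjoint_left.1 hSk hv
  -- With no neighbour of `a` in `S`, the other two clique vertices already cut `S` off from the
  -- rest, which is nonempty as it contains `a`.
  refine hG.not_isEdgeCut (x := x) (y := y) (C := (S : Set V))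
    (D := {v | v ∉ S ∧ v ≠ x ∧ v ≠ y}) hS ⟨a, fun h => hSk' a h ha, hx.1.symm, hy.1.symm⟩
    ⟨hk.isClique hx.2 hy.2 hxy, ?_, ?_, ?_, ?_⟩
  · intro v
    simp only [SetLike.mem_coe, Set.mem_ofPred_eq]
    tauto
  · exact Set.disjoint_left.2 fun v hv hv' => hv'.1 hv
  · rintro v (hv | hv)
    · exact ⟨fun e => hSk' v hv (e ▸ hx.2), fun e => hSk' v hv (e ▸ hy.2)⟩
    · exact hv.2
  · rintro c hc d ⟨hdS, hdx, hdy⟩ hcd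
    rcases hmem d ((hclosed c hc d hcd).resolve_left hdS) with rfl | rfl | rfl
    · exact hno c hc hcd
    · exact hdx rfl
    · exact hdy rfl

namespace Divides

variable {k S T k' S' T' : Finset V}

theorem symm (h : Divides G k S T) : Divides G k T S where
  disjoint := h.disjoint.symm
  union_eq := by rw [Finset.union_comm, h.union_eq]
  meets u hu v hv p := by
    obtain ⟨w, hw, hwk⟩ := h.meets v hv u hu p.reverse
    exact ⟨w, by simpa using hw, hwk⟩

theorem mem_iff (h : Divides G k S T) (v : V) : v ∈ S ∨ v ∈ T ↔ v ∉ k := by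
  rw [← Finset.mem_union, h.union_eq, Finset.mem_compl]

theorem not_adj (h : Divides G k S T) {u v : V} (hu : u ∈ S) (hv : v ∈ T) : ¬ G.Adj u v := by
  intro huv
  obtain ⟨w, hw, hwk⟩ := h.meets u hu v hv huv.toWalk
  have hw' : w = u ∨ w = v := by simpa using hw
  rcases hw' with rfl | rfl
  · exact (h.mem_iff w).1 (Or.inl hu) hwk
  · exact (h.mem_iff w).1 (Or.inr hv) hwk

theorem eq_compl (h : Divides G k S T) : k = (S ∪ T)ᶜ := by rw [h.union_eq, compl_compl]

/-- A clique has no vertices on one side of a separation. -/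
theorem disjoint_of_isClique (h : Divides G k S T) (hk' : G.IsClique (k' : Set V)) {a : V}
    (ha : a ∈ k') (haS : a ∈ S) : Disjoint k' T := by
  rw [Finset.disjoint_left]
  intro b hb hbT
  have hab : a ≠ b := fun e => Finset.disjoint_left.1 h.disjoint haS (e ▸ hbT)
  exact h.not_adj haS hbT (hk' ha hb hab)

/-- A side of the 3-clique `k` that does not meet `k'` lies on the same side of `k'` as any
vertex of `k`. -/
theorem side_subset (hG : IsMaximalPlanar G) (hk : G.IsNClique 3 k) (h : Divides G k S T)
    (h' : Divides G k' S' T') (hdisj : Disjoint k' S) {a : V} (ha : a ∈ k) (haS' : a ∈ S') :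
    S ⊆ S' := by
  by_contra hsub
  rw [← Finset.sdiff_nonempty] at hsub
  have hT' : ∀ s ∈ S \ S', s ∈ T' := by
    intro s hs
    rw [Finset.mem_sdiff] at hs
    exact ((h'.mem_iff s).2 (Finset.disjoint_right.1 hdisj hs.1)).resolve_left hs.2
  -- Edges leaving `S \ S'` cannot enter `S ∩ S'`, since `S \ S'` lies in `T'`; so they end in `k`.
  -- The attachment to `a` then gives an edge between `T'` and `S'`.
  obtain ⟨s, hs, hsa⟩ := hG.exists_adj hk ha hsub
    (Finset.disjoint_left.2 fun v hv => (h.mem_iff v).1 (Or.inl (Finset.mem_sdiff.1 hv).1))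
    fun s hs t hst => by
      by_contra! hcon
      have htS : t ∈ S := ((h.mem_iff t).2 hcon.2).resolve_right
        fun htT => h.not_adj (Finset.mem_sdiff.1 hs).1 htT hst
      have htS' : t ∈ S' := by
        by_contra htS'
        exact hcon.1 (Finset.mem_sdiff.2 ⟨htS, htS'⟩)
      exact h'.not_adj htS' (hT' s hs) hst.symm
  exact h'.not_adj haS' (hT' s hs) hsa.symm

end Divides

/-! ### Laminarity of the interiors -/

namespace Orientation

variable (O : Orientation G) {k k' : ThreeClique G}

theorem divides (k : ThreeClique G) : Divides G k.1 (O.interior k) (O.exterior k) :=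
  (O.areSides k).divides

theorem le_of_subset (hsub : O.interior k ⊆ O.interior k')
    (hdisj : Disjoint k.1 (O.exterior k')) : O.LE k k' := by
  refine Finset.union_subset (fun v hv => ?_) (hsub.trans Finset.subset_union_right)
  rw [Finset.mem_union]
  by_contra! hcon
  exact Finset.disjoint_left.1 hdisj hv
    ((((O.divides k').mem_iff v).2 hcon.1).resolve_left hcon.2)

/-- Two 3-cliques of a maximal planar graph have disjoint interiors or are comparable. -/
theorem disjoint_or_le (hG : IsMaximalPlanar G) (hne : k ≠ k') :
    Disjoint (O.interior k) (O.interior k') ∨ O.LE k k' ∨ O.LE k' k := by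
  have h := O.divides k
  have h' := O.divides k'
  by_cases h1 : Disjoint k.1 (O.interior k')
  · by_cases h2 : Disjoint k'.1 (O.interior k)
    · left
      obtain ⟨a, ha, hak'⟩ : ∃ a ∈ k.1, a ∉ k'.1 := by
        by_contra! hcon
        exact hne (Subtype.ext (Finset.eq_of_subset_of_card_le hcon
          (by rw [k.2.card_eq, k'.2.card_eq])))
      have haT : a ∈ O.exterior k' := ((h'.mem_iff a).2 hak').resolve_left
        (Finset.disjoint_left.1 h1 ha)
      exact h'.disjoint.symm.mono_left (Divides.side_subset hG k.2 h h'.symm h2 ha haT)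
    · obtain ⟨b, hb, hbS⟩ := Finset.not_disjoint_iff.1 h2
      exact Or.inr (Or.inr (O.le_of_subset (Divides.side_subset hG k'.2 h' h h1 hb hbS)
        (h.disjoint_of_isClique k'.2.isClique hb hbS)))
  · obtain ⟨a, ha, haS⟩ := Finset.not_disjoint_iff.1 h1
    have h1' := h'.disjoint_of_isClique k.2.isClique ha haS
    by_cases h2 : Disjoint k'.1 (O.interior k)
    · exact Or.inr (Or.inl (O.le_of_subset (Divides.side_subset hG k.2 h h' h2 ha haS) h1'))
    · obtain ⟨b, hb, hbS⟩ := Finset.not_disjoint_iff.1 h2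
      have h2' := h.disjoint_of_isClique k'.2.isClique hb hbS
      -- Each exterior lies in the other interior, and interiors are no larger than exteriors. All
      -- four orders are therefore equal, both inclusions are equalities, and the cliques have the
      -- same complement.
      have h3 := Divides.side_subset hG k.2 h.symm h' h2' ha haS
      have h4 := Divides.side_subset hG k'.2 h'.symm h h1' hb hbS
      have h5 := O.card_le k
      have h6 := O.card_le k'
      have h7 := Finset.card_le_card h3
      have h8 := Finset.card_le_card h4
      have e1 := Finset.eq_of_subset_of_card_le h3 (by omega)
      have e2 := Finset.eq_of_subset_of_card_le h4 (by omega)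
      exact absurd (Subtype.ext (by rw [h.eq_compl, h'.eq_compl, e1, e2, Finset.union_comm])) hne

end Orientation

end
end CliqueHierarchy

theorem mainTheorem11 {V : Type*} [Fintype V] [DecidableEq V] (G : SimpleGraph V)
    (hG : CliqueHierarchy.IsMaximalPlanar G) (O : CliqueHierarchy.Orientation G)
    (ki kj kl : CliqueHierarchy.ThreeClique G)
    (hj : O.IsIncomingNeighbor kj ki) (hl : O.IsIncomingNeighbor kl ki) (hjl : kj ≠ kl) :
    O.interior kj ∩ O.interior kl = ∅ := by
  rcases O.disjoint_or_le hG hjl with h | h | h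
  · exact Finset.disjoint_iff_inter_eq_empty.1 h
  · exact ((hj.2.2 kl h hl.1).elim (fun e => hjl e.symm) hl.2.1).elim
  · exact ((hl.2.2 kj h hj.1).elim hjl hj.2.1).elim
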